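/- **Setting.** Let $\mathcal I$ be the set of intervals $[s,t)$ with $-\infty<s<t<\infty$; write $I+u$ for the translate of $I$ by $u\in\mathbb R$, and $I<J$ if $s<t$ for all $s\in I$, $t\in J$. A *continuous Bernoulli system* $(\mathcal A,\varphi,(\mathcal A_I)_{I\in\mathcal I})$ consists of a von Neumann algebra $\mathcal A$ with separable predual, a faithful normal tracial state $\varphi$ on $\mathcal A$, and von Neumann subalgebras $\mathcal A_I\subseteq\mathcal A$ ($I\in\mathcal I$, with the same unit) which generate $\mathcal A$ as a von Neumann algebra, satisfy $\mathcal A_I\subseteq\mathcal A_J$ whenever $I\subseteq J$, and satisfy $\varphi(ab)=\varphi(a)\varphi(b)$ for $a\in\mathcal A_I$, $b\in\mathcal A_J$ whenever $I\cap J=\emptyset$. For $1\le p<\infty$ let $L^p(\mathcal A)$ be the completion of $\mathcal A$ for $\|x\|_p=\varphi(|x|^p)^{1/p}$, and put $L^{\infty-}(\mathcal A)=\bigcap_{1\le p<\infty}L^p(\mathcal A)$, an algebra to which $\varphi$ extends continuously. An *additive flow* is a family $(B_I)_{I\in\mathcal I}$ in $L^{\infty-}(\mathcal A)$ such that $(s,t)\mapsto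 B_{[s,t)}$ ($s<t$) is jointly continuous into $L^p(\mathcal A)$ for all $1\le p<\infty$, $B_I\in L^{\infty-}(\mathcal A_I)$ for all $I$, and $B_{[s,u)}=B_{[s,t)}+B_{[t,u)}$ for all $s<t<u$. The flow is *order invariant* if $$\varphi(B_{I_1}\cdots B_{I_n})=\varphi(B_{I_1+t_1}\cdots B_{I_n+t_n})$$ for all $n$, all $I_1,\dots,I_n\in\mathcal I$ such that for all $k,l$ either $I_k=I_l$ or $I_k\cap I_l=\emptyset$, and all $t_1,\dots,t_n\in\mathbb R$ such that for all $k,l$: $I_k=I_l$ implies $t_k=t_l$, and $I_k<I_l$ implies $I_k+t_k<I_l+t_l$. Two $n$-tuples $\mathbf i,\mathbf j:\{1,\dots,n\}\to\mathbb N$ are *order equivalent* if $i(k)\le i(l)\Leftrightarrow j(k)\le j(l)$ for all $k,l$. Let $\mathcal O(n)$ be the (finite) set of equivalence classes, and for $\sigma\in\mathcal O(n)$ let $|\sigma|$ be the number of elements in the range of any $\mathbf i\in\sigma$. **Proposition.** Let $(B_I)_{I\in\mathcal I}$ be an order invariant additive flow, and put $b_i^{(N)}=B_{[\frac{i-1}N,\frac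 iN)}$ for $1\le i\le N$. Then the distribution of the $b_i^{(N)}$ is order invariant: for all $n,N$ and all order equivalent $\mathbf i,\mathbf j:\{1,\dots,n\}\to\{1,\dots,N\}$, $$\varphi(b_{i(1)}^{(N)}\cdots b_{i(n)}^{(N)})=\varphi(b_{j(1)}^{(N)}\cdots b_{j(n)}^{(N)}).$$ Consequently, for $\sigma\in\mathcal O(n)$ and $N\ge|\sigma|$, the common value $\varphi(b_\sigma^{(N)})$ of $\varphi(b_{i(1)}^{(N)}\cdots b_{i(n)}^{(N)})$ over all $\mathbf i\in\sigma$ with values in $\{1,\dots,N\}$ is well defined. Moreover, for all $n$ and all $\sigma\in\mathcal O(n)$, the limit $$c(\sigma):=\lim_{N\to\infty}N^{|\sigma|}\,\varphi(b_\sigma^{(N)})$$ exists (in $\mathbb C$). -/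

import Mathlib

open scoped ComplexOrder Topology
open Filter

noncomputable section

namespace NCWhiteNoise

universe u

/-! ### Traces on C*-algebras and their noncommutative `L^p`-norms -/

section LpNorms

variable {M : Type*} [CStarAlgebra M] [PartialOrder M] [StarOrderedRing M]

/-- The noncommutative `L^p`-norm `‖x‖_p = φ(|x|^p)^{1/p}` with `|x| = (x* x)^{1/2}`. -/
def lpNorm (φ : M →ₗ[ℂ] ℂ) (p : ℝ) (x : M) : ℝ :=
  (φ (CFC.abs x ^ p)).re ^ (1 / p)

/-- `φ` is positive, tracial and takes the value `1` at the unit. -/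
structure IsTracialState (φ : M →ₗ[ℂ] ℂ) : Prop where
  map_one : φ 1 = 1
  pos : ∀ a : M, 0 ≤ φ (star a * a)
  tracial : ∀ a b : M, φ (a * b) = φ (b * a)

/-- Auxiliary: `‖x‖_p ^ p` for `p = 2 ^ (k + 1)`. -/
def evenMoment (φ : M →ₗ[ℂ] ℂ) (k : ℕ) (x : M) : ℝ :=
  (φ ((star x * x) ^ (2 ^ k))).re

variable {φ : M →ₗ[ℂ] ℂ}

namespace IsTracialState

lemma nonneg_of_nonneg (h : IsTracialState φ) {a : M} (ha : 0 ≤ a) : 0 ≤ φ a := by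
  obtain ⟨s, rfl⟩ := CStarAlgebra.nonneg_iff_eq_star_mul_self.mp ha
  exact h.pos s

lemma re_mono (h : IsTracialState φ) {a b : M} (hab : a ≤ b) : (φ a).re ≤ (φ b).re := by
  have := h.nonneg_of_nonneg (sub_nonneg.mpr hab)
  rw [map_sub, sub_nonneg] at this
  exact (Complex.le_def.mp this).1

lemma evenMoment_nonneg (h : IsTracialState φ) (k : ℕ) (x : M) : 0 ≤ evenMoment φ k x := by
  have h1 : (0 : M) ≤ (star x * x) ^ (2 ^ k) := CStarAlgebra.pow_nonneg (star_mul_self_nonneg x) _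
  exact (Complex.le_def.mp (h.nonneg_of_nonneg h1)).1

lemma ofReal_evenMoment (h : IsTracialState φ) (k : ℕ) (x : M) :
    ((evenMoment φ k x : ℝ) : ℂ) = φ ((star x * x) ^ (2 ^ k)) := by
  have h1 : (0 : M) ≤ (star x * x) ^ (2 ^ k) := CStarAlgebra.pow_nonneg (star_mul_self_nonneg x) _
  have h2 := (Complex.le_def.mp (h.nonneg_of_nonneg h1)).2
  apply Complex.ext
  · simp [evenMoment]
  · simpa using h2

lemma tracial_pow (h : IsTracialState φ) (a b : M) (n : ℕ) :
    φ ((a * b) ^ n) = φ ((b * a) ^ n) := by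
  cases n with
  | zero => simp
  | succ n =>
    have e : (a * b) ^ (n + 1) = a * (b * (a * b) ^ n) := by rw [pow_succ', mul_assoc]
    have e2 : b * (a * b) ^ n * a = (b * a) ^ (n + 1) := by
      clear e
      induction n with
      | zero => simp
      | succ n ih => 
        calc b * (a * b) ^ (n + 1) * a = (b * a) * (b * (a * b) ^ n * a) := by
              rw [pow_succ']; simp only [mul_assoc]
          _ = _ := by rw [ih, ← pow_succ']
    rw [e, h.tracial, e2]

lemma evenMoment_star (h : IsTracialState φ) (k : ℕ) (x : M) :
    evenMoment φ k (star x) = evenMoment φ k x := by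
  simp only [evenMoment, star_star]
  rw [h.tracial_pow]

/-- Cauchy-Schwarz. -/
lemma cauchySchwarz (h : IsTracialState φ) (x y : M) :
    ‖φ (x * y)‖ ^ 2 ≤ evenMoment φ 0 x * evenMoment φ 0 y := by
  let f : M →ₚ[ℂ] ℂ := PositiveLinearMap.mk₀ φ (fun a ha => h.nonneg_of_nonneg ha)
  have key := norm_inner_le_norm (𝕜 := ℂ) (f.toPreGNS (star x)) (f.toPreGNS y)
  rw [PositiveLinearMap.preGNS_inner_def] at key
  simp only [PositiveLinearMap.ofPreGNS_toPreGNS, star_star] at key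
  have e : ∀ z : M, ‖f.toPreGNS z‖ ^ 2 = evenMoment φ 0 z := by
    intro z
    have := f.preGNS_norm_sq (f.toPreGNS z)
    simp only [PositiveLinearMap.ofPreGNS_toPreGNS] at this
    have h2 := h.ofReal_evenMoment 0 z
    simp only [pow_zero, pow_one] at h2
    have h3 : (f (star z * z) : ℂ) = φ (star z * z) := rfl
    rw [h3, ← h2] at this
    exact_mod_cast this
  calc ‖φ (x * y)‖ ^ 2 ≤ (‖f.toPreGNS (star x)‖ * ‖f.toPreGNS y‖) ^ 2 := by
        gcongr; exact key
    _ = _ := by rw [mul_pow, e, e, h.evenMoment_star]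

lemma norm_evenMoment (h : IsTracialState φ) (k : ℕ) (x : M) :
    ‖φ ((star x * x) ^ (2 ^ k))‖ = evenMoment φ k x := by
  rw [← h.ofReal_evenMoment, Complex.norm_real, Real.norm_of_nonneg (h.evenMoment_nonneg k x)]

lemma evenMoment_star_mul_self (k : ℕ) (x : M) :
    evenMoment φ k (star x * x) = evenMoment φ (k + 1) x := by
  simp only [evenMoment, star_mul, star_star]
  rw [← pow_two (star x * x), ← pow_mul, pow_succ' 2 k]

/-- Pairs up consecutive letters of a word. -/
lemma exists_pairs (m : ℕ) : ∀ w : List M, w.length = 2 * m →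
    ∃ w' : List (M × M), w'.length = m ∧ w = (w'.map fun q => [q.1, q.2]).flatten := by
  induction m with
  | zero => intro w hw; exact ⟨[], rfl, by simpa using hw⟩
  | succ m ih =>
    intro w hw
    match w, hw with
    | a :: b :: w, hw =>
      obtain ⟨w', h1, h2⟩ := ih w (by simp at hw; omega)
      exact ⟨(a, b) :: w', by simp [h1], by simp [h2]⟩
    | [a], hw => simp at hw; omega
    | [], hw => simp at hw

/-- Hölder's inequality for words of length `2 ^ (k + 1)`, together with its consequence for
products of two elements. -/
lemma holder (h : IsTracialState φ) (k : ℕ) :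
    (∀ w : List M, w.length = 2 ^ (k + 1) →
      ‖φ w.prod‖ ^ (2 ^ (k + 1)) ≤ (w.map (evenMoment φ k)).prod) ∧
    ∀ x y : M, evenMoment φ k (x * y) ^ 2 ≤ evenMoment φ (k + 1) x * evenMoment φ (k + 1) y := by
  have step : ∀ k : ℕ, (∀ w : List M, w.length = 2 ^ (k + 1) →
      ‖φ w.prod‖ ^ (2 ^ (k + 1)) ≤ (w.map (evenMoment φ k)).prod) →
      ∀ x y : M, evenMoment φ k (x * y) ^ 2 ≤
        evenMoment φ (k + 1) x * evenMoment φ (k + 1) y := by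
    intro k hk x y
    have e1 : φ ((star (x * y) * (x * y)) ^ (2 ^ k)) =
        φ ((star x * x * (y * star y)) ^ (2 ^ k)) := by
      have : star (x * y) * (x * y) = star y * (star x * x * y) := by
        simp only [star_mul, mul_assoc]
      rw [this, h.tracial_pow]
      simp only [mul_assoc]
    have hw := hk ((List.replicate (2 ^ k) [star x * x, y * star y]).flatten)
      (by simp [pow_succ])
    have e2 : ((List.replicate (2 ^ k) [star x * x, y * star y]).flatten).prod =
        (star x * x * (y * star y)) ^ (2 ^ k) := by
      simp [List.prod_flatten]
    have e3 : (((List.replicate (2 ^ k) [star x * x, y * star y]).flatten).map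
        (evenMoment φ k)).prod =
        (evenMoment φ (k + 1) x * evenMoment φ (k + 1) y) ^ (2 ^ k) := by
      have h1 : evenMoment φ k (y * star y) = evenMoment φ (k + 1) y := by
        have := evenMoment_star_mul_self (φ := φ) k (star y)
        rw [star_star, h.evenMoment_star] at this
        exact this
      simp [List.map_flatten, List.prod_flatten, evenMoment_star_mul_self, h1]
    rw [e2, e3, ← e1, h.norm_evenMoment, pow_succ' 2 k, pow_mul] at hw
    exact le_of_pow_le_pow_left₀ (by positivity)
      (mul_nonneg (h.evenMoment_nonneg _ _) (h.evenMoment_nonneg _ _)) hw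
  have main : ∀ w : List M, w.length = 2 ^ (k + 1) →
      ‖φ w.prod‖ ^ (2 ^ (k + 1)) ≤ (w.map (evenMoment φ k)).prod := by
    induction k with
    | zero =>
      intro w hw
      match w, hw with
      | [a, b], _ => simpa using h.cauchySchwarz a b
    | succ k ih =>
      intro w hw
      obtain ⟨w', h1, rfl⟩ := exists_pairs (2 ^ (k + 1)) w (by rw [hw, pow_succ' 2 (k + 1)])
      have hp : ((w'.map fun q => [q.1, q.2]).flatten).prod =
          (w'.map fun q => q.1 * q.2).prod := by
        simp [List.prod_flatten, Function.comp_def]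
      have hq : (((w'.map fun q => [q.1, q.2]).flatten).map (evenMoment φ (k + 1))).prod =
          (w'.map fun q => evenMoment φ (k + 1) q.1 * evenMoment φ (k + 1) q.2).prod := by
        simp [List.prod_flatten, List.map_flatten, Function.comp_def]
      have h2 := ih (w'.map fun q => q.1 * q.2) (by simpa using h1)
      rw [hp, hq, pow_succ 2 (k + 1), pow_mul]
      rw [List.map_map] at h2
      have h3 : ∀ l : List (M × M),
          (l.map (evenMoment φ k ∘ fun q => q.1 * q.2)).prod ^ 2 ≤
          (l.map fun q => evenMoment φ (k + 1) q.1 * evenMoment φ (k + 1) q.2).prod := by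
        intro l
        induction l with
        | nil => simp
        | cons q l ihl =>
          simp only [List.map_cons, List.prod_cons, mul_pow, Function.comp_apply]
          exact mul_le_mul (step k ih q.1 q.2) ihl (sq_nonneg _)
            (mul_nonneg (h.evenMoment_nonneg _ _) (h.evenMoment_nonneg _ _))
      exact (pow_le_pow_left₀ (by positivity) h2 2).trans (h3 w')
  exact ⟨main, step k main⟩

lemma evenMoment_mul_sq_le (h : IsTracialState φ) (k : ℕ) (x y : M) :
    evenMoment φ k (x * y) ^ 2 ≤ evenMoment φ (k + 1) x * evenMoment φ (k + 1) y :=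
  (h.holder k).2 x y

lemma evenMoment_one (h : IsTracialState φ) (k : ℕ) : evenMoment φ k 1 = 1 := by
  simp [evenMoment, h.map_one]

lemma evenMoment_sq_le (h : IsTracialState φ) (k : ℕ) (x : M) :
    evenMoment φ k x ^ 2 ≤ evenMoment φ (k + 1) x := by
  have := h.evenMoment_mul_sq_le k x 1
  rwa [mul_one, h.evenMoment_one, mul_one] at this

lemma evenMoment_lt_of_le (h : IsTracialState φ) {k l : ℕ} (hkl : k ≤ l) {ε : ℝ} (hε : 0 < ε) :
    ∃ δ > 0, ∀ x : M, evenMoment φ l x < δ → evenMoment φ k x < ε := by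
  induction l, hkl using Nat.le_induction with
  | base => exact ⟨ε, hε, fun x hx => hx⟩
  | succ l _ ih =>
    obtain ⟨δ, hδ, hx⟩ := ih
    exact ⟨δ ^ 2, by positivity, fun x hlt => hx x
      (lt_of_pow_lt_pow_left₀ 2 hδ.le ((h.evenMoment_sq_le l x).trans_lt hlt))⟩

lemma evenMoment_add_le (h : IsTracialState φ) (k : ℕ) {δ : ℝ} (hδ : 0 ≤ δ) {x y : M}
    (hx : evenMoment φ k x ≤ δ) (hy : evenMoment φ k y ≤ δ) :
    evenMoment φ k (x + y) ≤ 2 ^ (2 ^ (k + 1)) * δ := by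
  have word : ∀ (Q : List (M × M)) (P : List M), P.length + Q.length = 2 ^ (k + 1) →
      (∀ a ∈ P, evenMoment φ k a ≤ δ) →
      (∀ q ∈ Q, evenMoment φ k q.1 ≤ δ ∧ evenMoment φ k q.2 ≤ δ) →
      ‖φ (P.prod * (Q.map fun q => q.1 + q.2).prod)‖ ≤ 2 ^ Q.length * δ := by
    intro Q
    induction Q with
    | nil =>
      intro P hP hPδ _
      have h1 := (h.holder k).1 P (by simpa using hP)
      have h2 : ∀ L : List M, (∀ a ∈ L, evenMoment φ k a ≤ δ) →
          (L.map (evenMoment φ k)).prod ≤ δ ^ L.length := by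
        intro L
        induction L with
        | nil => simp
        | cons a L ihL =>
          intro hL
          simp only [List.map_cons, List.prod_cons, List.length_cons, pow_succ']
          exact mul_le_mul (hL a (by simp)) (ihL fun b hb => hL b (by simp [hb]))
            (List.prod_nonneg (by
              simp only [List.mem_map]
              rintro _ ⟨b, _, rfl⟩
              exact h.evenMoment_nonneg k b)) hδ
      have h3 := h1.trans (h2 P hPδ)
      have hlen : P.length = 2 ^ (k + 1) := by simpa using hP
      rw [hlen] at h3
      simpa using le_of_pow_le_pow_left₀ (by positivity) hδ h3
    | cons q Q ih =>
      intro P hP hPδ hQ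
      have e : P.prod * ((q :: Q).map fun q => q.1 + q.2).prod =
          (P ++ [q.1]).prod * (Q.map fun q => q.1 + q.2).prod +
          (P ++ [q.2]).prod * (Q.map fun q => q.1 + q.2).prod := by
        simp [mul_add, add_mul, mul_assoc]
      have hlen : ∀ z : M, (P ++ [z]).length + Q.length = 2 ^ (k + 1) := by
        intro z; rw [← hP]; simp; omega
      have hmem : ∀ z : M, evenMoment φ k z ≤ δ → ∀ a ∈ P ++ [z], evenMoment φ k a ≤ δ := by
        intro z hz a ha
        rcases List.mem_append.mp ha with ha | ha
        · exact hPδ a ha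
        · rw [List.mem_singleton.mp ha]; exact hz
      have b1 := ih (P ++ [q.1]) (hlen _) (hmem _ (hQ q (by simp)).1)
        fun r hr => hQ r (by simp [hr])
      have b2 := ih (P ++ [q.2]) (hlen _) (hmem _ (hQ q (by simp)).2)
        fun r hr => hQ r (by simp [hr])
      rw [e, map_add, List.length_cons, pow_succ]
      calc _ ≤ _ := norm_add_le _ _
        _ ≤ 2 ^ Q.length * δ + 2 ^ Q.length * δ := add_le_add b1 b2
        _ = _ := by ring
  have hk := word ((List.replicate (2 ^ k) [(star x, star y), (x, y)]).flatten) []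
    (by simp [pow_succ]) (by simp) (by
      intro q hq
      simp only [List.mem_flatten, List.mem_replicate] at hq
      obtain ⟨l, ⟨_, rfl⟩, hq⟩ := hq
      simp only [List.mem_cons, List.not_mem_nil, or_false] at hq
      rcases hq with rfl | rfl
      · simpa [h.evenMoment_star] using And.intro hx hy
      · exact ⟨hx, hy⟩)
  have e : ([] : List M).prod *
      (((List.replicate (2 ^ k) [(star x, star y), (x, y)]).flatten).map
        fun q => q.1 + q.2).prod = (star (x + y) * (x + y)) ^ (2 ^ k) := by
    simp [List.map_flatten, List.prod_flatten]
  rw [e, h.norm_evenMoment] at hk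
  simpa [pow_succ] using hk

lemma evenMoment_lt_of_lpNorm_lt (h : IsTracialState φ) (k : ℕ) {ε : ℝ} (hε : 0 < ε) :
    ∃ p : ℝ, 1 ≤ p ∧ ∃ δ > 0, ∀ x : M, lpNorm φ p x < δ → evenMoment φ k x < ε := by
  have hp : (0 : ℝ) < ((2 ^ (k + 1) : ℕ) : ℝ) := by positivity
  refine ⟨((2 ^ (k + 1) : ℕ) : ℝ), by exact_mod_cast Nat.one_le_two_pow,
    ε ^ (1 / ((2 ^ (k + 1) : ℕ) : ℝ)), by positivity, fun x hx => ?_⟩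
  rw [lpNorm, CFC.rpow_natCast _ _ (CFC.abs_nonneg x), pow_succ' 2 k, pow_mul, pow_two,
    CFC.abs_mul_abs] at hx
  exact (Real.rpow_lt_rpow_iff (h.evenMoment_nonneg k x) hε.le
    (by positivity)).mp hx

lemma lpNorm_lt_of_evenMoment_lt (h : IsTracialState φ) {p : ℝ} (hp : 1 ≤ p) {ε : ℝ}
    (hε : 0 < ε) : ∃ k : ℕ, ∃ δ > 0, ∀ x : M, evenMoment φ k x < δ → lpNorm φ p x < ε := by
  obtain ⟨k, hk⟩ : ∃ k : ℕ, p ≤ ((2 ^ (k + 1) : ℕ) : ℝ) := by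
    obtain ⟨k, hk⟩ := exists_nat_ge p
    refine ⟨k, hk.trans ?_⟩
    exact_mod_cast (Nat.lt_two_pow_self.le.trans (Nat.pow_le_pow_right two_pos k.le_succ))
  set n : ℕ := 2 ^ (k + 1) with hn
  have hp0 : 0 < p := by linarith
  obtain ⟨d, hd0, hdε⟩ := exists_between hε
  have hdp : d ^ p < ε ^ p := Real.rpow_lt_rpow hd0.le hdε hp0
  set c : ℝ := d ^ (p - n) with hc
  have hc0 : 0 < c := Real.rpow_pos_of_pos hd0 _
  refine ⟨k, (ε ^ p - d ^ p) / c, div_pos (by linarith) hc0, fun x hx => ?_⟩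
  set a := CFC.abs x with ha
  have ha0 : 0 ≤ a := CFC.abs_nonneg x
  have hpow : a ^ n = (star x * x) ^ (2 ^ k) := by
    rw [hn, pow_succ' 2 k, pow_mul, pow_two, CFC.abs_mul_abs]
  have hle : a ^ p ≤ algebraMap ℝ M (d ^ p) + c • a ^ n := by
    have e : algebraMap ℝ M (d ^ p) + c • a ^ n =
        cfc (fun t : ℝ => d ^ p + c • t ^ n) a := by
      have hsa : IsSelfAdjoint a := ha0.isSelfAdjoint
      rw [cfc_const_add (d ^ p) (fun t : ℝ => c • t ^ n) a (by fun_prop) hsa,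
        cfc_smul c (fun t : ℝ => t ^ n) a (by fun_prop), cfc_pow_id a n hsa]
    rw [e, CFC.rpow_eq_cfc_real ha0]
    refine cfc_mono (fun t ht => ?_) (Real.continuous_rpow_const hp0.le).continuousOn
    have ht0 : 0 ≤ t := spectrum_nonneg_of_nonneg ha0 ht
    rcases le_or_gt t d with htd | htd
    · have h1 := Real.rpow_le_rpow ht0 htd hp0.le
      have : 0 ≤ c • t ^ n := by simp only [smul_eq_mul]; positivity
      linarith
    · have ht1 : 0 < t := hd0.trans htd
      have e2 : t ^ p = t ^ (p - n) * t ^ n := by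
        rw [← Real.rpow_natCast, ← Real.rpow_add ht1]; simp
      have h2 : t ^ (p - n) ≤ c :=
        Real.rpow_le_rpow_of_nonpos hd0 htd.le (by linarith)
      have h3 : t ^ p ≤ c * t ^ n := by rw [e2]; gcongr
      have : 0 < d ^ p := Real.rpow_pos_of_pos hd0 _
      simp only [smul_eq_mul]
      linarith
  have h1 := h.re_mono hle
  have h2 : (φ (algebraMap ℝ M (d ^ p) + c • a ^ n)).re = d ^ p + c * evenMoment φ k x := by
    rw [map_add, Algebra.algebraMap_eq_smul_one, LinearMap.map_smul_of_tower,
      LinearMap.map_smul_of_tower, h.map_one, hpow]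
    simp [evenMoment]
  rw [h2] at h1
  have h3 : c * evenMoment φ k x < ε ^ p - d ^ p := by
    rw [lt_div_iff₀ hc0] at hx; linarith
  have h4 : 0 ≤ (φ (a ^ p)).re := (Complex.le_def.mp (h.nonneg_of_nonneg CFC.rpow_nonneg)).1
  calc lpNorm φ p x < (ε ^ p) ^ (1 / p) :=
        Real.rpow_lt_rpow h4 (by linarith) (by positivity)
    _ = ε := by rw [one_div, Real.rpow_rpow_inv hε.le hp0.ne']

end IsTracialState

/-- The neighbourhoods of zero `{x | ‖x‖_p < ε}`, for all real `1 ≤ p < ∞` and `ε > 0`. They define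
the coarsest vector space topology on `M` for which all the norms `‖·‖_p` are continuous. -/
@[reducible]
def lpBasis (h : IsTracialState φ) : RingFilterBasis M :=
  have mem_of : ∀ (k : ℕ) (ε : ℝ), 0 < ε → ∃ V : Set M,
      (∃ p : ℝ, 1 ≤ p ∧ ∃ δ : ℝ, 0 < δ ∧ V = {x | lpNorm φ p x < δ}) ∧
      ∀ x ∈ V, evenMoment φ k x < ε := by
    intro k ε hε
    obtain ⟨p, hp, δ, hδ, H⟩ := h.evenMoment_lt_of_lpNorm_lt k hε
    exact ⟨_, ⟨p, hp, δ, hδ, rfl⟩, H⟩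
  { sets := {U | ∃ p : ℝ, 1 ≤ p ∧ ∃ ε : ℝ, 0 < ε ∧ U = {x | lpNorm φ p x < ε}}
    nonempty := ⟨_, 1, le_rfl, 1, one_pos, rfl⟩
    inter_sets := by
      rintro _ _ ⟨p, hp, ε, hε, rfl⟩ ⟨q, hq, η, hη, rfl⟩
      obtain ⟨k, δ, hδ, hk⟩ := h.lpNorm_lt_of_evenMoment_lt hp hε
      obtain ⟨l, γ, hγ, hl⟩ := h.lpNorm_lt_of_evenMoment_lt hq hη
      obtain ⟨δ', hδ', hk'⟩ := h.evenMoment_lt_of_le (le_max_left k l) hδ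
      obtain ⟨γ', hγ', hl'⟩ := h.evenMoment_lt_of_le (le_max_right k l) hγ
      obtain ⟨V, hV, H⟩ := mem_of (max k l) (min δ' γ') (lt_min hδ' hγ')
      exact ⟨V, hV, fun x hx => ⟨hk x (hk' x ((H x hx).trans_le (min_le_left _ _))),
        hl x (hl' x ((H x hx).trans_le (min_le_right _ _)))⟩⟩
    zero' := by
      rintro _ ⟨p, hp, ε, hε, rfl⟩
      obtain ⟨k, δ, hδ, hk⟩ := h.lpNorm_lt_of_evenMoment_lt hp hε
      exact hk 0 (by simpa [evenMoment] using hδ)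
    add' := by
      rintro _ ⟨p, hp, ε, hε, rfl⟩
      obtain ⟨k, δ, hδ, hk⟩ := h.lpNorm_lt_of_evenMoment_lt hp hε
      have hc : (0 : ℝ) < 2 ^ (2 ^ (k + 1)) := by positivity
      obtain ⟨V, hV, H⟩ := mem_of k (δ / 2 ^ (2 ^ (k + 1)) / 2) (by positivity)
      refine ⟨V, hV, ?_⟩
      rintro _ ⟨x, hx, y, hy, rfl⟩
      refine hk _ ((h.evenMoment_add_le k (by positivity) (H x hx).le (H y hy).le).trans_lt ?_)
      rw [← mul_div_assoc, mul_div_cancel₀ _ hc.ne']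
      linarith
    neg' := by
      rintro U hU
      refine ⟨U, hU, ?_⟩
      obtain ⟨p, hp, ε, hε, rfl⟩ := hU
      intro x hx
      simpa [lpNorm] using hx
    conj' := by
      rintro x₀ U hU
      exact ⟨U, hU, fun x hx => by simpa using hx⟩
    mul' := by
      rintro _ ⟨p, hp, ε, hε, rfl⟩
      obtain ⟨k, δ, hδ, hk⟩ := h.lpNorm_lt_of_evenMoment_lt hp hε
      obtain ⟨V, hV, H⟩ := mem_of (k + 1) δ hδ
      refine ⟨V, hV, ?_⟩
      rintro _ ⟨x, hx, y, hy, rfl⟩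
      refine hk _ (lt_of_pow_lt_pow_left₀ 2 hδ.le ((h.evenMoment_mul_sq_le k x y).trans_lt ?_))
      rw [pow_two]
      exact mul_lt_mul'' (H x hx) (H y hy) (h.evenMoment_nonneg _ _) (h.evenMoment_nonneg _ _)
    mul_left' := by
      rintro x₀ _ ⟨p, hp, ε, hε, rfl⟩
      obtain ⟨k, δ, hδ, hk⟩ := h.lpNorm_lt_of_evenMoment_lt hp hε
      have h0 := h.evenMoment_nonneg (k + 1) x₀
      obtain ⟨V, hV, H⟩ := mem_of (k + 1) (δ ^ 2 / (evenMoment φ (k + 1) x₀ + 1)) (by positivity)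
      refine ⟨V, hV, fun x hx => hk _ (lt_of_pow_lt_pow_left₀ 2 hδ.le
        ((h.evenMoment_mul_sq_le k x₀ x).trans_lt ?_))⟩
      have h1 := H x hx
      rw [lt_div_iff₀ (by positivity)] at h1
      nlinarith [h.evenMoment_nonneg (k + 1) x]
    mul_right' := by
      rintro x₀ _ ⟨p, hp, ε, hε, rfl⟩
      obtain ⟨k, δ, hδ, hk⟩ := h.lpNorm_lt_of_evenMoment_lt hp hε
      have h0 := h.evenMoment_nonneg (k + 1) x₀
      obtain ⟨V, hV, H⟩ := mem_of (k + 1) (δ ^ 2 / (evenMoment φ (k + 1) x₀ + 1)) (by positivity)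
      refine ⟨V, hV, fun x hx => hk _ (lt_of_pow_lt_pow_left₀ 2 hδ.le
        ((h.evenMoment_mul_sq_le k x x₀).trans_lt ?_))⟩
      have h1 := H x hx
      rw [lt_div_iff₀ (by positivity)] at h1
      nlinarith [h.evenMoment_nonneg (k + 1) x] }

end LpNorms

/-! ### Von Neumann algebras with a faithful normal trace, and `L^{∞-}` -/

section Trace

variable {H : Type*} [NormedAddCommGroup H] [InnerProductSpace ℂ H] [CompleteSpace H]

/-- The elements of a von Neumann algebra, as a type. -/
abbrev Elem (A : VonNeumannAlgebra H) : Type _ := A.toStarSubalgebra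

instance isClosed_vonNeumann (A : VonNeumannAlgebra H) :
    IsClosed (A.toStarSubalgebra : Set (H →L[ℂ] H)) := by
  rw [VonNeumannAlgebra.coe_toStarSubalgebra, ← A.centralizer_centralizer]
  exact Set.isClosed_centralizer _

/-- The order on a von Neumann algebra is the restriction of the order of operators. -/
instance starOrderedRing_vonNeumann (A : VonNeumannAlgebra H) : StarOrderedRing (Elem A) := by
  refine StarOrderedRing.of_nonneg_iff' (fun {x y} hxy z => ?_) (fun x => ⟨fun hx => ?_, ?_⟩)
  · exact add_le_add_right (α := H →L[ℂ] H) (show (x : H →L[ℂ] H) ≤ y from hxy) z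
  · have hx' : (0 : H →L[ℂ] H) ≤ x := hx
    have hs : CFC.sqrt (x : H →L[ℂ] H) ∈ A.toStarSubalgebra := by
      rw [← SetLike.mem_coe, VonNeumannAlgebra.coe_toStarSubalgebra, ← A.centralizer_centralizer]
      intro y hy
      have hc : Commute (x : H →L[ℂ] H) y := (hy x x.2)
      exact (hc.cfcₙ_nnreal _).symm
    refine ⟨⟨_, hs⟩, Subtype.ext ?_⟩
    have h1 : star (CFC.sqrt (x : H →L[ℂ] H)) = CFC.sqrt (x : H →L[ℂ] H) :=
      (CFC.sqrt_nonneg (x : H →L[ℂ] H)).isSelfAdjoint.star_eq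
    change (x : H →L[ℂ] H) = star (CFC.sqrt (x : H →L[ℂ] H)) * CFC.sqrt (x : H →L[ℂ] H)
    rw [h1, CFC.sqrt_mul_sqrt_self _ hx']
  · rintro ⟨s, rfl⟩
    exact star_mul_self_nonneg (s : H →L[ℂ] H)

/-- The predual of the von Neumann algebra (which is unique up to isometry) is separable. -/
def HasSeparablePredual {H : Type u} [NormedAddCommGroup H] [InnerProductSpace ℂ H]
    [CompleteSpace H] (A : VonNeumannAlgebra H) : Prop :=
  ∃ (X : Type u) (_ : NormedAddCommGroup X) (_ : NormedSpace ℂ X),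
    CompleteSpace X ∧ TopologicalSpace.SeparableSpace X ∧
      Nonempty (StrongDual ℂ X ≃ₗᵢ[ℂ] Elem A)

/-- A faithful normal tracial state on a von Neumann algebra. -/
structure FaithfulNormalTrace (A : VonNeumannAlgebra H) where
  /-- the functional `φ` -/
  φ : Elem A →ₗ[ℂ] ℂ
  isTracialState : IsTracialState φ
  faithful : ∀ a : Elem A, φ (star a * a) = 0 → a = 0
  /-- `φ` preserves suprema of bounded increasing families of positive elements. -/
  normal : ∀ (D : Set (Elem A)) (x : Elem A), D.Nonempty → (∀ a ∈ D, 0 ≤ a) →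
    DirectedOn (· ≤ ·) D → IsLUB D x → IsLUB ((fun a => (φ a).re) '' D) (φ x).re

variable {A : VonNeumannAlgebra H}

/-- The algebra `A`, to be equipped with the topology given by all the norms `‖·‖_p`,
`1 ≤ p < ∞`, instead of the operator norm. -/
def PreLInfMinus (_τ : FaithfulNormalTrace A) : Type _ := Elem A

namespace PreLInfMinus

variable (τ : FaithfulNormalTrace A)

instance : Ring (PreLInfMinus τ) := inferInstanceAs (Ring (Elem A))

instance : TopologicalSpace (PreLInfMinus τ) := (lpBasis τ.isTracialState).topology

instance : IsTopologicalRing (PreLInfMinus τ) :=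
  RingFilterBasis.isTopologicalRing (lpBasis τ.isTracialState)

instance : UniformSpace (PreLInfMinus τ) := IsTopologicalAddGroup.rightUniformSpace _

instance : IsUniformAddGroup (PreLInfMinus τ) := isUniformAddGroup_of_addCommGroup

/-- The trace, as a functional on `PreLInfMinus τ`. -/
def trace : PreLInfMinus τ →+ ℂ := τ.φ.toAddMonoidHom

lemma continuous_trace : Continuous (trace τ) := by
  refine continuous_of_continuousAt_zero (trace τ) ?_
  have hb := (lpBasis τ.isTracialState).toAddGroupFilterBasis.nhds_zero_hasBasis
  rw [ContinuousAt, map_zero]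
  refine (hb.tendsto_iff Metric.nhds_basis_ball).mpr fun ε hε => ?_
  obtain ⟨p, hp, δ, hδ, hx⟩ := τ.isTracialState.evenMoment_lt_of_lpNorm_lt 0 (sq_pos_of_pos hε)
  refine ⟨_, ⟨p, hp, δ, hδ, rfl⟩, fun x hxp => ?_⟩
  have h1 := τ.isTracialState.cauchySchwarz 1 x
  rw [one_mul, τ.isTracialState.evenMoment_one, one_mul] at h1
  rw [mem_ball_zero_iff]
  exact lt_of_pow_lt_pow_left₀ 2 hε.le (h1.trans_lt (hx x hxp))

end PreLInfMinus

/-- The algebra `L^{∞-}(A) = ⋂_{1 ≤ p < ∞} L^p(A)`, with its topology given by all the norms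
`‖·‖_p`. Each `L^p(A)` is the completion of `A` for `‖·‖_p`, and `L^q(A) ⊆ L^p(A)` for `p ≤ q`; the
intersection is complete for the family of all these norms, and `A` is dense in it (given `x` in the
intersection, choose `aₘ ∈ A` with `‖x - aₘ‖_m < 1 / m`). Hence it is the completion of `A` for the
family of norms `‖·‖_p`, `1 ≤ p < ∞`. Multiplication, which is jointly continuous for this
family by Hölder's inequality, extends to the completion. -/
abbrev LInfMinus (τ : FaithfulNormalTrace A) : Type _ := UniformSpace.Completion (PreLInfMinus τ)

namespace LInfMinus

variable (τ : FaithfulNormalTrace A)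

/-- The inclusion `A ⊆ L^{∞-}(A)`. -/
def ofElem (a : Elem A) : LInfMinus τ := ((show PreLInfMinus τ from a) : LInfMinus τ)

/-- The continuous extension of the trace `φ` from `A` to `L^{∞-}(A)`. -/
def trace : LInfMinus τ →+ ℂ :=
  (PreLInfMinus.trace τ).extension (PreLInfMinus.continuous_trace τ)

/-- For a von Neumann subalgebra `C` of `A`, the subspace `L^{∞-}(C)` of `L^{∞-}(A)`: the closure
of `C`. -/
def ofSubalgebra (C : VonNeumannAlgebra H) : Set (LInfMinus τ) :=
  closure (ofElem τ '' {a : Elem A | (a : H →L[ℂ] H) ∈ C})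

end LInfMinus

end Trace

/-! ### Continuous Bernoulli systems and additive flows -/

/-- The intervals `[s, t)` with `-∞ < s < t < ∞`. -/
@[ext]
structure TimeInterval where
  left : ℝ
  right : ℝ
  lt : left < right

namespace TimeInterval

/-- The underlying set `[s, t)`. -/
def toSet (I : TimeInterval) : Set ℝ := Set.Ico I.left I.right

/-- The translate `I + u`. -/
def shift (I : TimeInterval) (u : ℝ) : TimeInterval :=
  ⟨I.left + u, I.right + u, by have := I.lt; linarith⟩

/-- `I < J` : every point of `I` is strictly to the left of every point of `J`. -/
def Before (I J : TimeInterval) : Prop := ∀ s ∈ I.toSet, ∀ t ∈ J.toSet, s < t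

end TimeInterval

section Flow

variable {H : Type*} [NormedAddCommGroup H] [InnerProductSpace ℂ H] [CompleteSpace H]

variable (H) in
/-- A noncommutative continuous Bernoulli system `(A, φ, (A_I))`, with `A` acting on `H`. -/
structure ContinuousBernoulliSystem where
  /-- the von Neumann algebra `A` -/
  alg : VonNeumannAlgebra H
  separable : HasSeparablePredual alg
  /-- the faithful normal trace `φ` -/
  τ : FaithfulNormalTrace alg
  /-- the filtration `A_I` -/
  sub : TimeInterval → VonNeumannAlgebra H
  sub_le : ∀ I, sub I ≤ alg
  /-- global minimality: `A` is the smallest von Neumann algebra that contains all `A_I` -/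
  minimal : ∀ C : VonNeumannAlgebra H, (∀ I, sub I ≤ C) → alg ≤ C
  isotone : ∀ I J : TimeInterval, I.toSet ⊆ J.toSet → sub I ≤ sub J
  /-- `ℂ`-independence -/
  indep : ∀ I J : TimeInterval, Disjoint I.toSet J.toSet → ∀ a b : Elem alg,
    (a : H →L[ℂ] H) ∈ sub I → (b : H →L[ℂ] H) ∈ sub J → τ.φ (a * b) = τ.φ a * τ.φ b

/-- An additive `L^{∞-}`-flow for a continuous Bernoulli system. -/
structure AdditiveFlow (S : ContinuousBernoulliSystem H) where
  /-- the increments `B_I` -/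
  B : TimeInterval → LInfMinus S.τ
  /-- joint continuity of `(s, t) ↦ B_{[s, t)}` in all the norms `‖·‖_p`, `1 ≤ p < ∞` -/
  continuous : Continuous fun q : {q : ℝ × ℝ // q.1 < q.2} => B ⟨q.1.1, q.1.2, q.2⟩
  adapted : ∀ I, B I ∈ LInfMinus.ofSubalgebra S.τ (S.sub I)
  additive : ∀ (s t u : ℝ) (hst : s < t) (htu : t < u),
    B ⟨s, u, hst.trans htu⟩ = B ⟨s, t, hst⟩ + B ⟨t, u, htu⟩

namespace AdditiveFlow

variable {S : ContinuousBernoulliSystem H}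

/-- The mixed moment `φ(B_{I_1} ⋯ B_{I_n})`. -/
def moment (F : AdditiveFlow S) {n : ℕ} (I : Fin n → TimeInterval) : ℂ :=
  LInfMinus.trace S.τ (List.ofFn fun k => F.B (I k)).prod

/-- Order invariance of a flow: moments in increments over intervals which are pairwise equal or
disjoint do not change if the intervals are shifted in such a way that equal intervals stay equal
and the relative order of disjoint ones is preserved. -/
def IsOrderInvariant (F : AdditiveFlow S) : Prop :=
  ∀ (n : ℕ) (I : Fin n → TimeInterval) (t : Fin n → ℝ),
    (∀ k l, I k = I l ∨ Disjoint (I k).toSet (I l).toSet) →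
    (∀ k l, I k = I l → t k = t l) →
    (∀ k l, (I k).Before (I l) → ((I k).shift (t k)).Before ((I l).shift (t l))) →
    F.moment I = F.moment fun k => (I k).shift (t k)

/-- The increment `b_i^{(N)} = B_{[(i-1)/N, i/N)}` for `i = 1, …, N`, where the element `i` of
`Fin N` stands for the index `i + 1`. -/
def b (F : AdditiveFlow S) (N : ℕ) (i : Fin N) : LInfMinus S.τ :=
  F.B ⟨(i : ℝ) / N, ((i : ℝ) + 1) / N, by
    have : (0 : ℝ) < N := by exact_mod_cast i.pos
    gcongr
    linarith⟩

end AdditiveFlow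

end Flow

/-! ### Order equivalence of tuples of indices -/

/-- Order equivalence of `n`-tuples: `i(k) ≤ i(l) ↔ j(k) ≤ j(l)` for all `k, l`. -/
def orderSetoid (n : ℕ) : Setoid (Fin n → ℕ) where
  r i j := ∀ k l, i k ≤ i l ↔ j k ≤ j l
  iseqv := ⟨fun _ _ _ => Iff.rfl, fun h k l => (h k l).symm,
    fun h h' k l => (h k l).trans (h' k l)⟩

/-- The set `O(n)` of order equivalence classes of `n`-tuples. -/
abbrev OrderClass (n : ℕ) : Type := Quotient (orderSetoid n)

/-- The class of an `n`-tuple with values in `{1, …, N}` (a common shift of all the values does not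
change the class). -/
def classOf {n N : ℕ} (i : Fin n → Fin N) : OrderClass n :=
  Quotient.mk (orderSetoid n) fun k => (i k : ℕ)

lemma ncard_range_le {n : ℕ} {i j : Fin n → ℕ} (h : ∀ k l, i k ≤ i l ↔ j k ≤ j l) :
    (Set.range i).ncard ≤ (Set.range j).ncard := by
  have hs : Set.range i = (fun m => if hm : ∃ k, j k = m then i hm.choose else 0) '' Set.range j := by
    rw [← Set.range_comp]
    congr 1
    funext k
    have hm : ∃ k', j k' = j k := ⟨k, rfl⟩
    have he := hm.choose_spec
    simp only [Function.comp_apply, hm, dif_pos]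
    exact le_antisymm ((h _ _).mpr he.ge) ((h _ _).mpr he.le)
  rw [hs]
  exact Set.ncard_image_le (Set.finite_range j)

/-- `|σ|`, the number of elements in the range of any tuple in `σ`. -/
def OrderClass.size {n : ℕ} (σ : OrderClass n) : ℕ :=
  Quotient.lift (s := orderSetoid n) (fun i => (Set.range i).ncard)
    (fun _ _ h => le_antisymm (ncard_range_le h) (ncard_range_le fun k l => (h k l).symm)) σ

section Arrays

variable {H : Type*} [NormedAddCommGroup H] [InnerProductSpace ℂ H] [CompleteSpace H]
  {A : VonNeumannAlgebra H} {τ : FaithfulNormalTrace A}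

/-- `φ(b_{i(1)}^{(N)} ⋯ b_{i(n)}^{(N)})` for an array of random variables `b_i^{(N)}`, `i ≤ N`. -/
def arrayMoment (b : ∀ N : ℕ, Fin N → LInfMinus τ) (N : ℕ) {n : ℕ} (i : Fin n → Fin N) : ℂ :=
  LInfMinus.trace τ (List.ofFn fun k => b N (i k)).prod

/-- The distribution of the array `b_i^{(N)}` is order invariant. -/
def IsOrderInvariantArray (b : ∀ N : ℕ, Fin N → LInfMinus τ) : Prop :=
  ∀ (n N : ℕ) (i j : Fin n → Fin N), classOf i = classOf j →
    arrayMoment b N i = arrayMoment b N j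

open Classical in
/-- `φ(b_σ^{(N)})`: the value of `φ(b_i^{(N)})` for the tuples `i` in `σ` with values in
`{1, …, N}`. Such tuples exist if and only if `|σ| ≤ N`; the value for smaller `N` is set to `0`. -/
def classMoment (b : ∀ N : ℕ, Fin N → LInfMinus τ) (N : ℕ) {n : ℕ} (σ : OrderClass n) : ℂ :=
  if h : ∃ i : Fin n → Fin N, classOf i = σ then arrayMoment b N h.choose else 0

end Arrays

end NCWhiteNoise

end

noncomputable section

namespace NCWhiteNoise

/-! ### Order classes -/

namespace OrderClass

/-! The proof compares moments at scale `1` with moments at scale `1/N`. Fix a tuple `i`. The moment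
of the increments over the unit intervals `[i k, i k + 1)` does not depend on `N`. By additivity
each of these increments is a sum of `N` increments over intervals of length `1/N`, so the moment
expands into a sum over all tuples `i k * N + j k` with `j : Fin n → Fin N`. Order invariance makes
each summand depend only on the order class `τ` of that tuple, which gives
(`moment_eq_sum_classMoment`) the moment at scale `1` as the sum over `τ` of `refineCount i τ N`
times `classMoment F.b N τ`.

The coefficients have known asymptotics. Divided by `N ^ |τ|`, the count is a lattice point count of
mesh `1/N` in a bounded convex region, so it converges to the volume of that region
(`tendsto_refineCount_div_pow`). For the class `σ` of `i` itself the region is the unit cube, of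
volume `1` (`volume_refineRegion_self`). A class `τ ≠ σ` with `|τ| ≤ |σ|` never occurs, because
refining indices cannot merge distinct values (`refineCount_eq_zero`).

The identities therefore form a triangular system for the rescaled moments `N ^ |τ| * classMoment
F.b N τ`, with diagonal coefficients tending to `1`. Solving it by descending induction on `|σ|`
gives the limits. -/

lemma mk_eq_mk {n : ℕ} {i j : Fin n → ℕ} :
    (Quotient.mk (orderSetoid n) i : OrderClass n) = Quotient.mk (orderSetoid n) j ↔
      ∀ k l, i k ≤ i l ↔ j k ≤ j l :=
  Quotient.eq

lemma size_mk {n : ℕ} (i : Fin n → ℕ) :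
    OrderClass.size (Quotient.mk (orderSetoid n) i) = (Set.range i).ncard := rfl

lemma size_le {n : ℕ} (σ : OrderClass n) : σ.size ≤ n := by
  induction σ using Quotient.inductionOn with
  | h i =>
    rw [size_mk, ← Set.image_univ]
    refine (Set.ncard_image_le Set.finite_univ).trans ?_
    simp

/-- A class is determined by the relation `i k ≤ i l` on the finite set of positions. -/
instance (n : ℕ) : Finite (OrderClass n) := by
  let f : OrderClass n → Set (Fin n × Fin n) :=
    Quotient.lift (s := orderSetoid n) (fun i => {q | i q.1 ≤ i q.2}) fun i j h => by
      ext q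
      exact h q.1 q.2
  refine Finite.of_injective f fun σ τ => ?_
  induction σ, τ using Quotient.inductionOn₂ with
  | h i j =>
    intro h
    exact mk_eq_mk.mpr fun k l => Set.ext_iff.mp h (k, l)

instance (n : ℕ) : Fintype (OrderClass n) := Fintype.ofFinite _

/-- Every class of `n`-tuples contains a tuple with values in `Fin N` as soon as `n ≤ N`. -/
lemma exists_classOf_eq {n N : ℕ} (h : n ≤ N) (σ : OrderClass n) :
    ∃ i : Fin n → Fin N, classOf i = σ := by
  induction σ using Quotient.inductionOn with
  | h i =>
    -- Each entry is replaced by its rank, the number of values of the tuple strictly below it. An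
    -- entry is not below itself, so ranks are less than `V.card ≤ N`.
    let V : Finset ℕ := Finset.univ.image i
    have hV : V.card ≤ N := (Finset.card_image_le.trans (by simp)).trans h
    have hlt : ∀ k l, i k < i l → {v ∈ V | v < i k}.card < {v ∈ V | v < i l}.card := by
      intro k l hkl
      refine Finset.card_lt_card ((Finset.ssubset_iff_of_subset fun v hv => ?_).mpr ⟨i k, ?_, ?_⟩)
      · simp only [Finset.mem_filter] at hv ⊢
        exact ⟨hv.1, hv.2.trans hkl⟩
      · simp [V, hkl]
      · simp
    have hN : ∀ k, {v ∈ V | v < i k}.card < N := by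
      intro k
      refine lt_of_lt_of_le (Finset.card_lt_card
        ((Finset.ssubset_iff_of_subset (Finset.filter_subset _ _)).mpr ⟨i k, ?_, ?_⟩)) hV
      · simp [V]
      · simp
    refine ⟨fun k => ⟨_, hN k⟩, mk_eq_mk.mpr fun k l => ⟨fun hkl => ?_, fun hkl => ?_⟩⟩
    · by_contra hc
      exact absurd hkl (not_le.mpr (hlt l k (not_le.mp hc)))
    · refine Finset.card_le_card (s := {v ∈ V | v < i k}) (t := {v ∈ V | v < i l}) fun v hv => ?_
      simp only [Finset.mem_filter] at hv ⊢
      exact ⟨hv.1, hv.2.trans_le hkl⟩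

/-! ### Counting the refinements of a tuple by order class. -/

open Classical in
/-- The number of tuples in the class `σ` which are obtained from the tuple `i` by dividing every
index into `N` subindices. -/
def refineCount {n : ℕ} (i : Fin n → ℕ) (σ : OrderClass n) (N : ℕ) : ℕ :=
  (Finset.univ.filter fun j : Fin n → Fin N =>
    (Quotient.mk (orderSetoid n) fun k => i k * N + (j k : ℕ)) = σ).card

lemma mul_add_div_eq {N : ℕ} (a : ℕ) (b : Fin N) : (a * N + (b : ℕ)) / N = a := by
  rw [mul_comm, Nat.mul_add_div b.pos, Nat.div_eq_of_lt b.isLt, add_zero]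

/-- Division by `N` recovers `i` from any refinement, so it maps the values of the refinement onto
those of `i`. If the refinement has no more values than `i`, this monotone map is injective on them,
hence preserves order in both directions, and the refinement lies in the class of `i`. -/
lemma refineCount_eq_zero {n : ℕ} {i : Fin n → ℕ} {σ : OrderClass n} {N : ℕ}
    (hne : σ ≠ Quotient.mk (orderSetoid n) i)
    (hle : σ.size ≤ OrderClass.size (Quotient.mk (orderSetoid n) i)) :
    refineCount i σ N = 0 := by
  classical
  rw [refineCount, Finset.card_eq_zero, Finset.filter_eq_empty_iff]
  rintro j - rfl
  set q : Fin n → ℕ := fun k => i k * N + (j k : ℕ) with hq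
  have hdiv : ∀ k, q k / N = i k := fun k => mul_add_div_eq _ _
  have hr : Set.range i = (fun m => m / N) '' Set.range q := by
    rw [← Set.range_comp]
    exact congrArg Set.range (funext fun k => (hdiv k).symm)
  rw [size_mk, size_mk, hr] at hle
  have hinj := (Set.ncard_image_iff (Set.finite_range q)).mp
    (le_antisymm (Set.ncard_image_le (Set.finite_range q)) hle)
  refine hne (mk_eq_mk.mpr fun k l => ⟨fun h => ?_, fun h => ?_⟩)
  · rw [← hdiv k, ← hdiv l]
    exact Nat.div_le_div_right h
  · by_contra hc
    have h1 : q l / N ≤ q k / N := Nat.div_le_div_right (not_le.mp hc).le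
    rw [hdiv, hdiv] at h1
    have h2 : q k / N = q l / N := by rw [hdiv, hdiv, le_antisymm h h1]
    exact hc (hinj ⟨k, rfl⟩ ⟨l, rfl⟩ h2).le

/-! ### Asymptotics of the counts: lattice points in convex regions. -/

/-- The real analogue of the tuples counted by `refineCount`. -/
def refineRegion {n : ℕ} (i i' : Fin n → ℕ) : Set (Set.range i' → ℝ) :=
  {x | (∀ v, x v ∈ Set.Ico (0 : ℝ) 1) ∧
    (∀ k l, i' k ≤ i' l → i k + x ⟨i' k, k, rfl⟩ ≤ i l + x ⟨i' l, l, rfl⟩) ∧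
    ∀ k l, i' k < i' l → i k + x ⟨i' k, k, rfl⟩ < i l + x ⟨i' l, l, rfl⟩}

/-- Splitting order equivalence into weak and strict implications turns every constraint into a
linear inequality in `x`, so the region is an intersection of half-spaces, open or closed. -/
lemma convex_refineRegion {n : ℕ} (i i' : Fin n → ℕ) : Convex ℝ (refineRegion i i') := by
  rintro x ⟨hx0, hx1, hx2⟩ y ⟨hy0, hy1, hy2⟩ a b ha hb hab
  have key : ∀ (c : ℝ) v, c + (a • x + b • y) v = a * (c + x v) + b * (c + y v) := by
    intro c v
    simp only [Pi.add_apply, Pi.smul_apply, smul_eq_mul]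
    linear_combination (-c) * hab
  refine ⟨fun v => convex_Ico (0 : ℝ) 1 (hx0 v) (hy0 v) ha hb hab, fun k l h => ?_, fun k l h => ?_⟩
  · rw [key, key]
    exact add_le_add (mul_le_mul_of_nonneg_left (hx1 k l h) ha)
      (mul_le_mul_of_nonneg_left (hy1 k l h) hb)
  · rw [key, key]
    -- A strict inequality survives only through a positive weight, so the case `a = 0`, where `b =
    -- 1`, is separate.
    rcases ha.eq_or_lt with rfl | ha
    · rw [zero_add] at hab
      simpa [hab] using hy2 k l h
    · exact add_lt_add_of_lt_of_le (mul_lt_mul_of_pos_left (hx2 k l h) ha)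
        (mul_le_mul_of_nonneg_left (hy2 k l h).le hb)

lemma isBounded_refineRegion {n : ℕ} (i i' : Fin n → ℕ) :
    Bornology.IsBounded (refineRegion i i') := by
  refine (Metric.isBounded_Icc (0 : Set.range i' → ℝ) 1).subset fun x hx => ⟨fun v => ?_, fun v => ?_⟩
  · exact (hx.1 v).1
  · exact (hx.1 v).2.le

lemma measurableSet_refineRegion {n : ℕ} (i i' : Fin n → ℕ) :
    MeasurableSet (refineRegion i i') := by
  unfold refineRegion
  simp only [Set.ofPred_and, Set.ofPred_forall]
  refine (MeasurableSet.iInter fun v => ?_).inter ((MeasurableSet.iInter fun k =>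
    MeasurableSet.iInter fun l => MeasurableSet.iInter fun _ => ?_).inter
    (MeasurableSet.iInter fun k => MeasurableSet.iInter fun l => MeasurableSet.iInter fun _ => ?_))
  · exact measurable_pi_apply v measurableSet_Ico
  · exact measurableSet_le (by fun_prop) (by fun_prop)
  · exact measurableSet_lt (by fun_prop) (by fun_prop)

-- If the refined tuple is in the class of `i'`, then `j` is constant where `i'` is, so `j` amounts
-- to a function on the range of `i'`. Dividing it by `N` gives a point of the lattice of mesh
-- `1/N`, and multiplying the constraints by `N` gives back the integer inequalities.
open scoped Pointwise in
lemma refineCount_eq_card {n : ℕ} (i i' : Fin n → ℕ) {N : ℕ} (hN : 0 < N) :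
    refineCount i (Quotient.mk (orderSetoid n) i') N =
      Nat.card ↑(refineRegion i i' ∩ (N : ℝ)⁻¹ •
        (Submodule.span ℤ (Set.range (Pi.basisFun ℝ (Set.range i'))) :
          Set (Set.range i' → ℝ))) := by
  classical
  have hN0 : (0 : ℝ) < N := by exact_mod_cast hN
  have : NeZero N := ⟨hN.ne'⟩
  let J := Finset.univ.filter fun j : Fin n → Fin N =>
    (Quotient.mk (orderSetoid n) fun k => i k * N + (j k : ℕ)) = Quotient.mk (orderSetoid n) i'
  have hJ : ∀ j, j ∈ J ↔ ∀ k l, i k * N + (j k : ℕ) ≤ i l * N + (j l : ℕ) ↔ i' k ≤ i' l := by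
    intro j
    simp only [J, Finset.mem_filter, Finset.mem_univ, true_and]
    exact mk_eq_mk
  -- Equal values `i k * N + j k` have equal quotients and hence equal remainders modulo `N`.
  have hfac : ∀ j ∈ J, ∀ k l, i' k = i' l → j k = j l := by
    intro j hj k l hkl
    have h1 := ((hJ j).mp hj k l).mpr hkl.le
    have h2 := ((hJ j).mp hj l k).mpr hkl.ge
    have h3 : (i k * N + (j k : ℕ)) / N = (i l * N + (j l : ℕ)) / N := by rw [le_antisymm h1 h2]
    rw [mul_add_div_eq, mul_add_div_eq] at h3
    rw [h3] at h1 h2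
    exact Fin.ext (by omega)
  -- The chosen preimage of `v` under `i'` is arbitrary; `hfac` makes the choice irrelevant for `j ∈
  -- J`.
  let f : (Fin n → Fin N) → (Set.range i' → ℝ) := fun j v => ((j v.2.choose : ℕ) : ℝ) / N
  have hf : ∀ j ∈ J, ∀ k, f j ⟨i' k, k, rfl⟩ = ((j k : ℕ) : ℝ) / N := by
    intro j hj k
    have hv : ∃ k', i' k' = i' k := ⟨k, rfl⟩
    simp only [f]
    rw [hfac j hj hv.choose k hv.choose_spec]
  have hcast : ∀ (a b : ℕ), (a : ℝ) + (b : ℝ) / N = ((a * N + b : ℕ) : ℝ) / N := by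
    intro a b
    push_cast
    field_simp
  have hbij : Set.BijOn f J (refineRegion i i' ∩ (N : ℝ)⁻¹ •
        (Submodule.span ℤ (Set.range (Pi.basisFun ℝ (Set.range i'))) :
          Set (Set.range i' → ℝ))) := by
    refine ⟨fun j hj => ⟨⟨fun v => ⟨by positivity, ?_⟩, fun k l h => ?_, fun k l h => ?_⟩, ?_⟩,
      fun j hj j' hj' h => ?_, ?_⟩
    · rw [div_lt_one hN0]
      exact_mod_cast (j v.2.choose).isLt
    · rw [hf j hj, hf j hj, hcast, hcast]
      exact div_le_div_of_nonneg_right (Nat.cast_le.mpr (((hJ j).mp hj k l).mpr h)) hN0.le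
    · rw [hf j hj, hf j hj, hcast, hcast]
      refine div_lt_div_of_pos_right (Nat.cast_lt.mpr ?_) hN0
      exact lt_of_not_ge fun hc => absurd (((hJ j).mp hj l k).mp hc) (not_le.mpr h)
    · refine BoxIntegral.unitPartition.mem_smul_span_iff.mpr fun v => ?_
      exact ⟨(j v.2.choose : ℕ), by simp only [f]; push_cast; field_simp⟩
    · funext k
      have h1 := congrFun h ⟨i' k, k, rfl⟩
      rw [hf j hj, hf j' hj', div_left_inj' hN0.ne'] at h1
      exact Fin.ext (by exact_mod_cast h1)
    · rintro x ⟨⟨hx0, hx1, hx2⟩, hxL⟩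
      choose z hz using BoxIntegral.unitPartition.mem_smul_span_iff.mp hxL
      have hz' : ∀ v, ((z v : ℤ) : ℝ) = N * x v := fun v => by simpa using hz v
      have hz0 : ∀ v, 0 ≤ z v := by
        intro v
        have : (0 : ℝ) ≤ z v := by rw [hz']; exact mul_nonneg hN0.le (hx0 v).1
        exact_mod_cast this
      have hzN : ∀ v, z v < N := by
        intro v
        have : (z v : ℝ) < N := by
          rw [hz']; exact mul_lt_of_lt_one_right hN0 (hx0 v).2
        exact_mod_cast this
      have hxz : ∀ v, x v = (((z v).toNat : ℕ) : ℝ) / N := by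
        intro v
        have : (((z v).toNat : ℕ) : ℝ) = z v := by
          exact_mod_cast congrArg (Int.cast (R := ℝ)) (Int.toNat_of_nonneg (hz0 v))
        rw [this, hz']
        field_simp
      let j : Fin n → Fin N := fun k =>
        ⟨(z ⟨i' k, k, rfl⟩).toNat, by have := hzN ⟨i' k, k, rfl⟩; omega⟩
      have hj : j ∈ J := by
        refine (hJ j).mpr fun k l => ⟨fun h => ?_, fun h => ?_⟩
        · by_contra hc
          have h1 := hx2 l k (not_le.mp hc)
          rw [hxz, hxz, hcast, hcast, div_lt_div_iff_of_pos_right hN0, Nat.cast_lt] at h1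
          exact absurd h (not_le.mpr h1)
        · have h1 := hx1 k l h
          rw [hxz, hxz, hcast, hcast, div_le_div_iff_of_pos_right hN0, Nat.cast_le] at h1
          exact h1
      refine ⟨j, hj, funext ?_⟩
      rintro ⟨_, k, rfl⟩
      rw [hf j hj, hxz]
  rw [Nat.card_congr (hbij.equiv f).symm]
  simp [refineCount, J]

-- The frontier of a convex set is a null set, so normalised lattice point counts in a bounded
-- measurable convex set converge to its volume. The exponent is the dimension, the number of values
-- of `i'`.
open scoped Pointwise in
lemma tendsto_refineCount_div_pow {n : ℕ} (i i' : Fin n → ℕ) :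
    Tendsto (fun N : ℕ => (refineCount i (Quotient.mk (orderSetoid n) i') N : ℝ) /
        (N : ℝ) ^ OrderClass.size (Quotient.mk (orderSetoid n) i')) atTop
      (𝓝 (MeasureTheory.volume.real (refineRegion i i'))) := by
  refine (tendsto_card_div_pow_atTop_volume _ (isBounded_refineRegion i i')
    (measurableSet_refineRegion i i')
    ((convex_refineRegion i i').addHaar_frontier MeasureTheory.volume)).congr' ?_
  filter_upwards [eventually_gt_atTop 0] with N hN
  rw [refineCount_eq_card i i' hN, size_mk, ← Nat.card_coe_set_eq,
    Nat.card_eq_fintype_card (α := Set.range i')]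

/-- Distinct integers differ by at least `1`, so offsets in `[0, 1)` cannot disturb their order: all
order constraints are automatic and the region is the whole cube. -/
lemma volume_refineRegion_self {n : ℕ} (i : Fin n → ℕ) :
    MeasureTheory.volume.real (refineRegion i i) = 1 := by
  have h : refineRegion i i = Set.univ.pi fun _ => Set.Ico (0 : ℝ) 1 := by
    ext x
    refine ⟨fun hx v _ => hx.1 v, fun hx => ?_⟩
    have hlt : ∀ k l, i k < i l → i k + x ⟨i k, k, rfl⟩ < i l + x ⟨i l, l, rfl⟩ := by
      intro k l h
      have h1 : (i k : ℝ) + 1 ≤ i l := by exact_mod_cast h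
      have h2 := (hx ⟨i k, k, rfl⟩ trivial).2
      have h3 := (hx ⟨i l, l, rfl⟩ trivial).1
      linarith
    refine ⟨fun v => hx v trivial, fun k l h => ?_, hlt⟩
    rcases h.lt_or_eq with h | h
    · exact (hlt k l h).le
    · simp only [h, le_refl]
  rw [h, MeasureTheory.measureReal_def, MeasureTheory.volume_pi_pi]
  simp

end OrderClass

/-! ### Moments in increments over the intervals of a grid -/

/-- The interval `[m / N, (m + 1) / N)`. -/
def gridInterval (N : ℕ) [NeZero N] (m : ℕ) : TimeInterval :=
  ⟨(m : ℝ) / N, ((m : ℝ) + 1) / N, by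
    have : (0 : ℝ) < N := by exact_mod_cast NeZero.pos N
    gcongr
    linarith⟩

lemma gridInterval_before {N : ℕ} [NeZero N] {m m' : ℕ} :
    (gridInterval N m).Before (gridInterval N m') ↔ m < m' := by
  have hN : (0 : ℝ) < N := by exact_mod_cast NeZero.pos N
  constructor
  · intro h
    have := h ((m : ℝ) / N) ⟨le_rfl, (gridInterval N m).lt⟩ ((m' : ℝ) / N)
      ⟨le_rfl, (gridInterval N m').lt⟩
    rw [div_lt_div_iff_of_pos_right hN] at this
    exact_mod_cast this
  · intro h s hs t ht
    have h1 : ((m : ℝ) + 1) / N ≤ (m' : ℝ) / N := by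
      gcongr
      exact_mod_cast h
    exact hs.2.trans_le (h1.trans ht.1)

lemma gridInterval_injective (N : ℕ) [NeZero N] : Function.Injective (gridInterval N) := by
  intro m m' h
  have hN : (N : ℝ) ≠ 0 := by exact_mod_cast NeZero.ne N
  have h1 : (m : ℝ) / N = (m' : ℝ) / N := congrArg TimeInterval.left h
  rw [div_left_inj' hN] at h1
  exact_mod_cast h1

lemma TimeInterval.Before.disjoint {I J : TimeInterval} (h : I.Before J) :
    Disjoint I.toSet J.toSet :=
  Set.disjoint_left.mpr fun s hs ht => lt_irrefl s (h s hs s ht)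

lemma gridInterval_shift {N : ℕ} [NeZero N] (m m' : ℕ) :
    (gridInterval N m).shift (((m' : ℝ) - m) / N) = gridInterval N m' := by
  ext
  · simp only [TimeInterval.shift, gridInterval]; ring
  · simp only [TimeInterval.shift, gridInterval]; ring

namespace AdditiveFlow

variable {H : Type*} [NormedAddCommGroup H] [InnerProductSpace ℂ H] [CompleteSpace H]
  {S : ContinuousBernoulliSystem H}

/-- The moments over the intervals of a grid depend only on the order class of the indices. -/
lemma IsOrderInvariant.moment_gridInterval_eq {F : AdditiveFlow S} (hF : F.IsOrderInvariant)
    {n N : ℕ} [NeZero N] {i j : Fin n → ℕ} (h : ∀ k l, i k ≤ i l ↔ j k ≤ j l) :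
    F.moment (fun k => gridInterval N (i k)) = F.moment (fun k => gridInterval N (j k)) := by
  -- Each interval is translated separately, from the grid position `i k` to the position `j k`.
  rw [hF n (fun k => gridInterval N (i k)) (fun k => ((j k : ℝ) - i k) / N)]
  · simp only [gridInterval_shift]
  · intro k l
    rcases lt_trichotomy (i k) (i l) with hkl | hkl | hkl
    · exact Or.inr (gridInterval_before.mpr hkl).disjoint
    · exact Or.inl (congrArg _ hkl)
    · exact Or.inr (gridInterval_before.mpr hkl).disjoint.symm
  · intro k l hkl
    have h1 := gridInterval_injective N hkl
    have h2 : j k = j l := le_antisymm ((h k l).mp h1.le) ((h l k).mp h1.ge)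
    rw [h1, h2]
  · intro k l hkl
    simp only [gridInterval_shift, gridInterval_before] at hkl ⊢
    exact lt_of_not_ge fun hc => absurd ((h l k).mpr hc) (not_le.mpr hkl)

lemma arrayMoment_b (F : AdditiveFlow S) {n N : ℕ} [NeZero N] (i : Fin n → Fin N) :
    arrayMoment F.b N i = F.moment fun k => gridInterval N (i k) := rfl

lemma IsOrderInvariant.isOrderInvariantArray {F : AdditiveFlow S} (hF : F.IsOrderInvariant) :
    IsOrderInvariantArray F.b := by
  intro n N i j h
  rcases Nat.eq_zero_or_pos N with rfl | hN
  · rw [Subsingleton.elim i j]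
  · have : NeZero N := ⟨hN.ne'⟩
    rw [arrayMoment_b, arrayMoment_b]
    exact hF.moment_gridInterval_eq (OrderClass.mk_eq_mk.mp h)

/-- The bound `n ≤ N` guarantees a representative in `Fin N`, so the default value `0` is not used.
The entries of `i` themselves may exceed `N`: the flow lives on the whole line and order invariance
reaches beyond `[0, 1)`. -/
lemma IsOrderInvariant.classMoment_mk {F : AdditiveFlow S} (hF : F.IsOrderInvariant)
    {n N : ℕ} [NeZero N] (hn : n ≤ N) (i : Fin n → ℕ) :
    classMoment F.b N (Quotient.mk (orderSetoid n) i) =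
      F.moment fun k => gridInterval N (i k) := by
  have h := OrderClass.exists_classOf_eq hn (Quotient.mk (orderSetoid n) i)
  rw [classMoment, dif_pos h, arrayMoment_b]
  exact hF.moment_gridInterval_eq (OrderClass.mk_eq_mk.mp h.choose_spec)

/-! ### Subdividing unit intervals and expanding their moments. -/

lemma B_eq_sum (F : AdditiveFlow S) (N : ℕ) [NeZero N] (a K : ℕ)
    (h : (a : ℝ) / N < ((a : ℝ) + (K + 1 : ℕ)) / N) :
    F.B ⟨(a : ℝ) / N, ((a : ℝ) + (K + 1 : ℕ)) / N, h⟩ =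
      ∑ j ∈ Finset.range (K + 1), F.B (gridInterval N (a + j)) := by
  have hN : (0 : ℝ) < N := by exact_mod_cast NeZero.pos N
  -- The number of pieces is `K + 1` because a `TimeInterval` is nonempty; the induction starts with
  -- a single piece.
  induction K with
  | zero =>
    simp [gridInterval]
  | succ K ih =>
    have h1 : (a : ℝ) / N < ((a : ℝ) + (K + 1 : ℕ)) / N := by
      gcongr
      have : (0 : ℝ) < (K + 1 : ℕ) := by positivity
      linarith
    have h2 : ((a : ℝ) + (K + 1 : ℕ)) / N < ((a : ℝ) + (K + 1 + 1 : ℕ)) / N := by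
      gcongr
      omega
    rw [Finset.sum_range_succ, ← ih h1, F.additive _ _ _ h1 h2]
    congr 2
    ext
    · simp [gridInterval]
    · simp only [gridInterval]; push_cast; ring

lemma B_gridInterval_one (F : AdditiveFlow S) (N : ℕ) [NeZero N] (m : ℕ) :
    F.B (gridInterval 1 m) = ∑ j : Fin N, F.B (gridInterval N (m * N + j)) := by
  rw [Fin.sum_univ_eq_sum_range fun j => F.B (gridInterval N (m * N + j))]
  have hN : (N : ℝ) ≠ 0 := by exact_mod_cast NeZero.ne N
  obtain ⟨K, rfl⟩ := Nat.exists_eq_succ_of_ne_zero (NeZero.ne N)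
  have e1 : (gridInterval 1 m).left = ((m * (K + 1) : ℕ) : ℝ) / (K + 1 : ℕ) := by
    simp only [gridInterval]; push_cast at hN ⊢; field_simp
  have e2 : (gridInterval 1 m).right =
      (((m * (K + 1) : ℕ) : ℝ) + (K + 1 : ℕ)) / (K + 1 : ℕ) := by
    simp only [gridInterval]; push_cast at hN ⊢; field_simp
  have h := (gridInterval 1 m).lt
  rw [e1, e2] at h
  rw [← B_eq_sum F (K + 1) (m * (K + 1)) K h]
  congr 1
  ext
  · exact e1
  · exact e2

lemma moment_gridInterval_one (F : AdditiveFlow S) {n : ℕ} (N : ℕ) [NeZero N] (i : Fin n → ℕ) :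
    F.moment (fun k => gridInterval 1 (i k)) =
      ∑ j : Fin n → Fin N, F.moment fun k => gridInterval N (i k * N + j k) := by
  -- Multilinearity over `ℤ` suffices, since only finite sums are expanded.
  have h := (MultilinearMap.mkPiAlgebraFin ℤ n (LInfMinus S.τ)).map_sum
    (fun (k : Fin n) (j : Fin N) => F.B (gridInterval N (i k * N + j)))
  simp only [MultilinearMap.mkPiAlgebraFin_apply] at h
  simp only [moment, F.B_gridInterval_one N, h, map_sum]

lemma IsOrderInvariant.moment_eq_sum_classMoment {F : AdditiveFlow S} (hF : F.IsOrderInvariant)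
    {n N : ℕ} [NeZero N] (hn : n ≤ N) (i : Fin n → ℕ) :
    F.moment (fun k => gridInterval 1 (i k)) =
      ∑ σ : OrderClass n, (σ.refineCount i N : ℂ) * classMoment F.b N σ := by
  classical
  rw [F.moment_gridInterval_one N i, ← Finset.sum_fiberwise Finset.univ
    (fun j : Fin n → Fin N => (Quotient.mk (orderSetoid n) fun k => i k * N + (j k : ℕ)))]
  refine Finset.sum_congr rfl fun σ _ => ?_
  rw [Finset.sum_congr rfl (g := fun _ => classMoment F.b N σ), Finset.sum_const, nsmul_eq_mul]
  · simp only [OrderClass.refineCount]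
  · intro j hj
    rw [← (Finset.mem_filter.mp hj).2, hF.classMoment_mk hn]

/-! ### Solving the triangular system for the limits. -/

/-- The rescaled moments of an order invariant flow converge. -/
lemma IsOrderInvariant.exists_tendsto_classMoment {F : AdditiveFlow S} (hF : F.IsOrderInvariant)
    {n : ℕ} (σ : OrderClass n) :
    ∃ c : ℂ, Tendsto (fun N : ℕ => (N : ℂ) ^ σ.size * classMoment F.b N σ) atTop (𝓝 c) := by
  classical
  -- Descending induction on `|σ|`, which is bounded by `n`: the classes with more values than `σ`
  -- are settled first.
  induction hd : n - σ.size using Nat.strong_induction_on generalizing σ with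
  | _ d ih =>
  subst hd
  induction σ using Quotient.inductionOn with
  | h i =>
  set σ : OrderClass n := Quotient.mk (orderSetoid n) i with hσ
  -- The power of `N` is moved from the count to the moment, so that `w τ N * u τ N` is the summand
  -- of `τ` once `N > 0`, while `w τ` converges.
  let w : OrderClass n → ℕ → ℂ := fun τ N => (τ.refineCount i N : ℂ) / (N : ℂ) ^ τ.size
  let u : OrderClass n → ℕ → ℂ := fun τ N => (N : ℂ) ^ τ.size * classMoment F.b N τ
  have hw : ∀ i' : Fin n → ℕ, Tendsto (w (Quotient.mk (orderSetoid n) i')) atTop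
      (𝓝 ((MeasureTheory.volume.real (OrderClass.refineRegion i i') : ℝ) : ℂ)) := by
    intro i'
    have := (Complex.continuous_ofReal.tendsto _).comp
      (OrderClass.tendsto_refineCount_div_pow i i')
    refine this.congr fun N => ?_
    simp [w]
  have hw1 : Tendsto (w σ) atTop (𝓝 1) := by
    simpa [OrderClass.volume_refineRegion_self] using hw i
  have hrest : ∀ τ ∈ Finset.univ.erase σ, ∃ c : ℂ, Tendsto (fun N => w τ N * u τ N) atTop (𝓝 c) := by
    intro τ hτ
    rcases le_or_gt τ.size σ.size with hle | hlt
    · refine ⟨0, tendsto_const_nhds.congr fun N => ?_⟩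
      simp [w, OrderClass.refineCount_eq_zero (Finset.ne_of_mem_erase hτ) hle]
    · obtain ⟨c, hc⟩ := ih (n - τ.size) (by have := τ.size_le; omega) τ rfl
      obtain ⟨i', rfl⟩ := Quotient.exists_rep τ
      exact ⟨_, (hw i').mul hc⟩
  choose! c hc using hrest
  -- The expansion is solved for the term of `σ`, which is possible once `w σ N`, tending to `1`, is
  -- nonzero.
  have hsum : ∀ᶠ N : ℕ in atTop, (F.moment (fun k => gridInterval 1 (i k)) -
      ∑ τ ∈ Finset.univ.erase σ, w τ N * u τ N) / w σ N = u σ N := by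
    filter_upwards [eventually_ge_atTop n, eventually_gt_atTop 0,
      hw1.eventually_ne one_ne_zero] with N hn hN hw0
    have : NeZero N := ⟨hN.ne'⟩
    have hN0 : (N : ℂ) ≠ 0 := by exact_mod_cast hN.ne'
    have hwu : ∀ τ, (τ.refineCount i N : ℂ) * classMoment F.b N τ = w τ N * u τ N := by
      intro τ
      simp only [w, u]
      field_simp
    rw [div_eq_iff hw0, hF.moment_eq_sum_classMoment hn i]
    simp only [hwu]
    rw [← Finset.add_sum_erase _ _ (Finset.mem_univ σ)]
    ring
  exact ⟨_, ((tendsto_const_nhds.sub (tendsto_finsetSum _ hc)).div hw1 one_ne_zero).congr' hsum⟩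

end AdditiveFlow

end NCWhiteNoise

end

theorem mainTheorem6 {H : Type*} [NormedAddCommGroup H] [InnerProductSpace ℂ H] [CompleteSpace H]
    (S : NCWhiteNoise.ContinuousBernoulliSystem H) (F : NCWhiteNoise.AdditiveFlow S)
    (hF : F.IsOrderInvariant) :
    NCWhiteNoise.IsOrderInvariantArray F.b ∧
      ∀ (n : ℕ) (σ : NCWhiteNoise.OrderClass n),
        ∃ c : ℂ, Tendsto (fun N : ℕ => (N : ℂ) ^ σ.size * NCWhiteNoise.classMoment F.b N σ)
          atTop (𝓝 c) :=
  ⟨hF.isOrderInvariantArray, fun _ σ => hF.exists_tendsto_classMoment σ⟩
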